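/- Conventions. Second-order arithmetic is two-sorted classical first-order logic with equality between numbers, with variables $x,y,\dots$ for numbers and $X,Y,\dots$ for sets of numbers, over the symbols $0,\mathsf{s},+,\times,<$ and atomic formulas $t\in X$; both sorts range over arbitrary non-empty domains, and $T\vdash\varphi$ means that the closed formula $\varphi$ is a logical consequence of $T$. A formula is bounded if all its quantifiers are of the form $\forall x<t$ or $\exists x<t$, and $\Sigma^0_1$ if it has the form $\exists\vec x\,\varphi$ with $\varphi$ bounded; free number and set variables are allowed. The theory $\mathsf{RCA}_0$ consists of Robinson arithmetic with $<$, the induction axioms $\varphi(0)\wedge\forall x(\varphi(x)\supset\varphi(\mathsf{s}x))\supset\forall x\,\varphi(x)$ for $\varphi\in\Sigma^0_1$, and the recursive comprehension axioms $\forall x(\varphi(x)\equiv\neg\psi(x))\supset\exists X\,\forall x(x\in X\equiv\varphi(x))$ for $\varphi,\psi\in\Sigma^0_1$ in which $X$ is not free (universal closures are taken in both schemes). Let $(S,\bullet)$ be a finite semigroup. Inside arithmetic, its elements are represented, via an arbitrary fixed numbering, by the numerals below $|S|$, and its multiplication by its finite table. Write $\binom{\mathbb N}{2}$ for the set of pairs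 $(i,j)$ of numbers with $i<j$. A colouring $C:\binom{\mathbb N}{2}\to S$ is given by the set of codes of the triples $((i,j),c)$ with $C(i,j)=c$, where $\langle x,y\rangle=(x+y)^2+x$ codes pairs. It is additive if $C(i,j)\bullet C(j,k)=C(i,k)$ whenever $i<j<k$. For $a\in S$, a set $I\subseteq\mathbb N$ is an $a$-clique under $C$ if $C(i,j)=a$ for all $i,j\in I$ with $i<j$, and it is infinite if it has elements above every number. Theorem (Nonuniform Additive Ramsey Theorem). For every finite semigroup $(S,\bullet)$, $$\mathsf{RCA}_0\vdash \forall C:\tbinom{\mathbb N}{2}\to S.\ \bigl(\text{``}C\text{ is additive''}\supset \exists a\in S.\ \exists I\subseteq\mathbb N.\ \text{``}I\text{ is an infinite }a\text{-clique''}\bigr).$$ -/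

import Mathlib

/-! Second-order arithmetic as a two-sorted first-order logic, the theory `RCA₀`, and the
sentence expressing the additive Ramsey theorem for a fixed finite semigroup.

Variables are well-scoped de Bruijn indices: a formula in `Formula k n` has its free set variables
in `Fin k` and its free number variables in `Fin n`; a quantifier binds index `0` and shifts the
other indices of its sort by one. -/

universe u v w

namespace SOArith

/-- Number terms over `0, S, +, ×` with `n` free number variables. -/
inductive Term : ℕ → Type
  | var {n : ℕ} (i : Fin n) : Term n
  | zero {n : ℕ} : Term n
  | succ {n : ℕ} (t : Term n) : Term n
  | add {n : ℕ} (s t : Term n) : Term n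
  | mul {n : ℕ} (s t : Term n) : Term n

/-- Formulas of the language of second-order arithmetic. Equality is only between numbers, as is
usual (equality of sets is coextensionality). -/
inductive Formula : ℕ → ℕ → Type
  | eq {k n : ℕ} (s t : Term n) : Formula k n
  | lt {k n : ℕ} (s t : Term n) : Formula k n
  | mem {k n : ℕ} (t : Term n) (X : Fin k) : Formula k n
  | neg {k n : ℕ} (φ : Formula k n) : Formula k n
  | and {k n : ℕ} (φ ψ : Formula k n) : Formula k n
  | or {k n : ℕ} (φ ψ : Formula k n) : Formula k n
  | all {k n : ℕ} (φ : Formula k (n + 1)) : Formula k n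
  | ex {k n : ℕ} (φ : Formula k (n + 1)) : Formula k n
  | allSet {k n : ℕ} (φ : Formula (k + 1) n) : Formula k n
  | exSet {k n : ℕ} (φ : Formula (k + 1) n) : Formula k n

/-- Closed formulas. -/
abbrev Sentence : Type := Formula 0 0

/-- A theory is a set of closed formulas. -/
abbrev Theory : Type := Set Sentence

/-! ### Substitution -/

namespace Term

/-- Simultaneous substitution of terms for number variables. -/
def subst {n m : ℕ} (σ : Fin n → Term m) : Term n → Term m
  | var i => σ i
  | zero => zero
  | succ t => succ (t.subst σ)
  | add s t => add (s.subst σ) (t.subst σ)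
  | mul s t => mul (s.subst σ) (t.subst σ)

/-- Weakening by a new number variable with index `0`. -/
def lift {n : ℕ} (t : Term n) : Term (n + 1) := t.subst (fun i => var i.succ)

/-- The numeral `S (S (⋯ 0))`. -/
def numeral {n : ℕ} : ℕ → Term n
  | 0 => zero
  | m + 1 => succ (numeral m)

/-- The pairing `⟨s, t⟩ = (s + t)² + s`. -/
def pair {n : ℕ} (s t : Term n) : Term n := add (mul (add s t) (add s t)) s

end Term

namespace Formula

/-- Simultaneous capture-avoiding substitution of terms for number variables and renaming of set
variables. -/
def subst : {k l n m : ℕ} → (Fin k → Fin l) → (Fin n → Term m) → Formula k n → Formula l m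
  | _, _, _, _, _, σ, eq s t => eq (s.subst σ) (t.subst σ)
  | _, _, _, _, _, σ, lt s t => lt (s.subst σ) (t.subst σ)
  | _, _, _, _, τ, σ, mem t X => mem (t.subst σ) (τ X)
  | _, _, _, _, τ, σ, neg φ => neg (φ.subst τ σ)
  | _, _, _, _, τ, σ, and φ ψ => and (φ.subst τ σ) (ψ.subst τ σ)
  | _, _, _, _, τ, σ, or φ ψ => or (φ.subst τ σ) (ψ.subst τ σ)
  | _, _, _, _, τ, σ, all φ => all (φ.subst τ (Fin.cons (.var 0) fun i => (σ i).lift))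
  | _, _, _, _, τ, σ, ex φ => ex (φ.subst τ (Fin.cons (.var 0) fun i => (σ i).lift))
  | _, _, _, _, τ, σ, allSet φ => allSet (φ.subst (Fin.cons 0 fun X => (τ X).succ) σ)
  | _, _, _, _, τ, σ, exSet φ => exSet (φ.subst (Fin.cons 0 fun X => (τ X).succ) σ)

/-! ### Defined connectives -/

variable {k n : ℕ}

/-- Implication. -/
def imp (φ ψ : Formula k n) : Formula k n := or (neg φ) ψ

/-- Equivalence. -/
def iff (φ ψ : Formula k n) : Formula k n := and (imp φ ψ) (imp ψ φ)

/-- Finite disjunction (the empty one is a contradiction). -/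
def disj : List (Formula k n) → Formula k n
  | [] => neg (eq .zero .zero)
  | φ :: L => or φ (disj L)

/-- `∀ x < t. φ`, where `x` (index `0` in `φ`) does not occur in `t`. -/
def allLT (t : Term n) (φ : Formula k (n + 1)) : Formula k n :=
  all (imp (lt (.var 0) t.lift) φ)

/-- `∃ x < t. φ`, where `x` (index `0` in `φ`) does not occur in `t`. -/
def exLT (t : Term n) (φ : Formula k (n + 1)) : Formula k n :=
  ex (and (lt (.var 0) t.lift) φ)

/-- Universal closure over all free number variables. -/
def closeNum : {n : ℕ} → Formula k n → Formula k 0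
  | 0, φ => φ
  | _ + 1, φ => closeNum (all φ)

/-- Universal closure over all free set variables. -/
def closeSet : {k : ℕ} → Formula k 0 → Sentence
  | 0, φ => φ
  | _ + 1, φ => closeSet (allSet φ)

/-- Universal closure. -/
def closure (φ : Formula k n) : Sentence := closeSet (closeNum φ)

/-- Bounded (`Δ⁰₀`) formulas: all quantifiers are bounded number quantifiers; free set variables
are allowed. -/
inductive IsBounded : {k n : ℕ} → Formula k n → Prop
  | eq {k n : ℕ} (s t : Term n) : IsBounded (Formula.eq (k := k) s t)
  | lt {k n : ℕ} (s t : Term n) : IsBounded (Formula.lt (k := k) s t)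
  | mem {k n : ℕ} (t : Term n) (X : Fin k) : IsBounded (Formula.mem t X)
  | neg {k n : ℕ} {φ : Formula k n} : IsBounded φ → IsBounded (Formula.neg φ)
  | and {k n : ℕ} {φ ψ : Formula k n} :
      IsBounded φ → IsBounded ψ → IsBounded (Formula.and φ ψ)
  | or {k n : ℕ} {φ ψ : Formula k n} :
      IsBounded φ → IsBounded ψ → IsBounded (Formula.or φ ψ)
  | allLT {k n : ℕ} (t : Term n) {φ : Formula k (n + 1)} :
      IsBounded φ → IsBounded (Formula.allLT t φ)
  | exLT {k n : ℕ} (t : Term n) {φ : Formula k (n + 1)} :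
      IsBounded φ → IsBounded (Formula.exLT t φ)

/-- `Σ⁰₁` formulas: a block of existential number quantifiers in front of a bounded formula. -/
inductive IsSigma1 : {k n : ℕ} → Formula k n → Prop
  | bounded {k n : ℕ} {φ : Formula k n} : IsBounded φ → IsSigma1 φ
  | ex {k n : ℕ} {φ : Formula k (n + 1)} : IsSigma1 φ → IsSigma1 (Formula.ex φ)

/-- `φ(0)`, for the variable `x` with index `0`. -/
def substZero (φ : Formula k (n + 1)) : Formula k n :=
  φ.subst id (Fin.cons .zero .var)

/-- `φ(S x)`, for the variable `x` with index `0`. -/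
def substSucc (φ : Formula k (n + 1)) : Formula k (n + 1) :=
  φ.subst id (Fin.cons (.succ (.var 0)) fun i => .var i.succ)

/-- Weakening by a new set variable with index `0`. -/
def liftSet (φ : Formula k n) : Formula (k + 1) n := φ.subst Fin.succ .var

/-- The induction axiom `φ(0) ∧ ∀ x (φ(x) ⊃ φ(S x)) ⊃ ∀ x φ(x)`, with parameters. -/
def induction (φ : Formula k (n + 1)) : Sentence :=
  closure (imp (and φ.substZero (all (imp φ φ.substSucc))) (all φ))

/-- The comprehension axiom
`∀ x (φ(x) ≡ ¬ ψ(x)) ⊃ ∃ X ∀ x (x ∈ X ≡ φ(x))`, with parameters. -/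
def comprehension (φ ψ : Formula k (n + 1)) : Sentence :=
  closure (imp (all (iff φ (neg ψ))) (exSet (all (iff (mem (.var 0) 0) φ.liftSet))))

end Formula

open Formula Term in
/-- Robinson arithmetic with inequality. -/
def robinson : Theory :=
  { all (neg (eq (succ (var 0)) zero)),
    all (all (imp (eq (succ (var 1)) (succ (var 0))) (eq (var 1) (var 0)))),
    all (imp (neg (eq (var 0) zero)) (ex (eq (var 1) (succ (var 0))))),
    all (eq (add (var 0) zero) (var 0)),
    all (all (eq (add (var 1) (succ (var 0))) (succ (add (var 1) (var 0))))),
    all (eq (mul (var 0) zero) zero),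
    all (all (eq (mul (var 1) (succ (var 0))) (add (mul (var 1) (var 0)) (var 1)))),
    all (all (iff (lt (var 1) (var 0)) (ex (eq (add (var 2) (succ (var 0))) (var 1))))) }

/-- `RCA₀`: Robinson arithmetic, `Σ⁰₁` induction, and recursive (`Δ⁰₁`) comprehension. -/
def RCA₀ : Theory :=
  robinson
    ∪ {θ | ∃ (k n : ℕ) (φ : Formula k (n + 1)), φ.IsSigma1 ∧ θ = φ.induction}
    ∪ {θ | ∃ (k n : ℕ) (φ ψ : Formula k (n + 1)),
        φ.IsSigma1 ∧ ψ.IsSigma1 ∧ θ = φ.comprehension ψ}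

/-! ### Structures and logical consequence -/

/-- A two-sorted structure for the language of second-order arithmetic. Both sorts are arbitrary
nonempty domains; the second sort need not contain all subsets of the first. -/
structure Model where
  Num : Type u
  Sets : Type v
  zero : Num
  succ : Num → Num
  add : Num → Num → Num
  mul : Num → Num → Num
  lt : Num → Num → Prop
  mem : Num → Sets → Prop
  sets_nonempty : Nonempty Sets

/-- The value of a term. -/
def Term.eval (M : Model.{u, v}) {n : ℕ} (x : Fin n → M.Num) : Term n → M.Num
  | var i => x i
  | zero => M.zero
  | succ t => M.succ (t.eval M x)
  | add s t => M.add (s.eval M x) (t.eval M x)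
  | mul s t => M.mul (s.eval M x) (t.eval M x)

/-- Satisfaction of a formula under an assignment of its set and number variables. -/
def Formula.Holds (M : Model.{u, v}) :
    {k n : ℕ} → (Fin k → M.Sets) → (Fin n → M.Num) → Formula k n → Prop
  | _, _, _, x, eq s t => s.eval M x = t.eval M x
  | _, _, _, x, lt s t => M.lt (s.eval M x) (t.eval M x)
  | _, _, X, x, mem t i => M.mem (t.eval M x) (X i)
  | _, _, X, x, neg φ => ¬ φ.Holds M X x
  | _, _, X, x, and φ ψ => φ.Holds M X x ∧ ψ.Holds M X x
  | _, _, X, x, or φ ψ => φ.Holds M X x ∨ ψ.Holds M X x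
  | _, _, X, x, all φ => ∀ a : M.Num, φ.Holds M X (Fin.cons a x)
  | _, _, X, x, ex φ => ∃ a : M.Num, φ.Holds M X (Fin.cons a x)
  | _, _, X, x, allSet φ => ∀ A : M.Sets, φ.Holds M (Fin.cons A X) x
  | _, _, X, x, exSet φ => ∃ A : M.Sets, φ.Holds M (Fin.cons A X) x

/-- Truth of a sentence in a structure. -/
def Model.Satisfies (M : Model.{u, v}) (θ : Sentence) : Prop :=
  θ.Holds M Fin.elim0 Fin.elim0

/-- `T ⊢ θ`: the sentence `θ` is a logical consequence of `T` in two-sorted first-order logic. -/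
def Proves (T : Theory) (θ : Sentence) : Prop :=
  ∀ M : Model.{u, v}, (∀ χ ∈ T, M.Satisfies χ) → M.Satisfies θ

/-! ### The additive Ramsey theorem as a sentence

A finite semigroup `S` with a numbering `e : S ≃ Fin s` is presented inside arithmetic by the
numbers below `s`, and its multiplication by a finite multiplication table. A colouring `C` of
pairs `i < j` is a set of codes `⟨⟨i, j⟩, c⟩`. -/

namespace Formula

variable {k n : ℕ}

/-- `C(i, j) = c`, i.e. `⟨⟨i, j⟩, c⟩ ∈ C`. -/
def colourEq (C : Fin k) (i j c : Term n) : Formula k n :=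
  mem (Term.pair (Term.pair i j) c) C

/-- `C` is a function from `{(i, j) | i < j}` to `{0, …, s - 1}`: every element of `C` has the
form `⟨⟨i, j⟩, c⟩` with `i < j` and `c < s`, and for all `i < j` there is exactly one `c < s`
with `⟨⟨i, j⟩, c⟩ ∈ C`. -/
def isColouring (s : ℕ) (C : Fin k) : Formula k 0 :=
  and
    -- the variables are `z = 3, i = 2, j = 1, c = 0`
    (all (imp (mem (.var 0) C)
      (ex (ex (ex (and (and (lt (.var 2) (.var 1)) (lt (.var 0) (.numeral s)))
        (eq (.var 3) (Term.pair (Term.pair (.var 2) (.var 1)) (.var 0)))))))))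
    -- the variables are `i = 3, j = 2, c = 1, d = 0`
    (all (all (imp (lt (.var 1) (.var 0))
      (ex (and (and (lt (.var 0) (.numeral s)) (colourEq C (.var 2) (.var 1) (.var 0)))
        (all (imp (and (lt (.var 0) (.numeral s)) (colourEq C (.var 3) (.var 2) (.var 0)))
          (eq (.var 0) (.var 1)))))))))

/-- `x • y = z` in the semigroup `S`: the disjunction over all `a, b ∈ S` of
`x = a ∧ y = b ∧ z = a • b`. -/
def mulTable {S : Type w} [Mul S] {s : ℕ} (e : S ≃ Fin s) (x y z : Term n) : Formula k n :=
  disj ((List.finRange s ×ˢ List.finRange s).map fun p =>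
    and (and (eq x (.numeral p.1)) (eq y (.numeral p.2)))
      (eq z (.numeral (e (e.symm p.1 * e.symm p.2)))))

/-- `C` is additive: `C(i, j) • C(j, l) = C(i, l)` whenever `i < j < l`. -/
def isAdditive {S : Type w} [Mul S] {s : ℕ} (e : S ≃ Fin s) (C : Fin k) : Formula k 0 :=
  -- the variables are `i = 5, j = 4, l = 3, x = 2, y = 1, z = 0`
  all (all (all (all (all (all (imp
    (and (and (lt (.var 5) (.var 4)) (lt (.var 4) (.var 3)))
      (and (and (colourEq C (.var 5) (.var 4) (.var 2)) (colourEq C (.var 4) (.var 3) (.var 1)))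
        (colourEq C (.var 5) (.var 3) (.var 0))))
    (mulTable e (.var 2) (.var 1) (.var 0))))))))

/-- `I` is infinite (unbounded). -/
def isInfinite (I : Fin k) : Formula k n :=
  all (ex (and (lt (.var 1) (.var 0)) (mem (.var 0) I)))

/-- `I` is an `a`-clique under `C`: `C(i, j) = a` for all `i < j` in `I`. -/
def isClique (C I : Fin k) (a : Term n) : Formula k n :=
  all (all (imp (and (and (mem (.var 1) I) (mem (.var 0) I)) (lt (.var 1) (.var 0)))
    (colourEq C (.var 1) (.var 0) a.lift.lift)))

/-- The sentence: for every additive colouring `C` of pairs into `S` there are `a ∈ S` and a set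
`I` such that `I` is an infinite `a`-clique. -/
def additiveRamsey {S : Type w} [Mul S] {s : ℕ} (e : S ≃ Fin s) : Sentence :=
  -- `C` is the set variable `0`, and the set variable `1` under the quantifier for `I`
  allSet (imp (and (isColouring s 0) (isAdditive e 0))
    (exLT (.numeral s) (exSet (and (isInfinite 0) (isClique 1 0 (.var 0))))))

end Formula

end SOArith

/-! Call `i` and `j` merging if `C(i, l) = C(j, l)` for some `l`. By additivity `i` and `j` then
have the same colour with every larger number, so merging is an equivalence relation with
finitely many classes. Outside the model, an ultrafilter on its numbers selects a class, a
member `r` of it and a colour `a` such that the members `i` of the class with `C(r, i) = a` are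
unbounded. As the classes are finitely many, these `i` form a set `A` of the model: a number is
outside the class of `r` iff it merges with one of the other representatives.

Any greedily built `a`-clique `I ⊆ A` is unbounded. Indeed, if `I` were bounded, then by collection
all its members would have merged with `r` at a common number `l`, and any `x ∈ A` beyond `l` and
`I` would satisfy `C(y, x) = C(r, x) = a` for all `y ∈ I`, and so belong to `I`.

The greedy recursion in the model needs codes for finite sets: the pair `(b, c)` codes the set of
all `x` with `1 + (x + 1) b ∣ c`, and multiplying `c` by `1 + (y + 1) b` adds just the element `y`
below `n` if `b` is a common multiple of `1, …, n`. -/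

namespace SOArith

open Filter

variable {M : Model.{u, v}}

/-! ### Semantics of substitution and of universal closure -/

namespace Term

variable {n m : ℕ}

theorem eval_subst (σ : Fin n → Term m) (x : Fin m → M.Num) (t : Term n) :
    (t.subst σ).eval M x = t.eval M fun i => (σ i).eval M x := by
  induction t with
  | var i => rfl
  | zero => rfl
  | succ t ih => simp only [subst, eval, ih]
  | add s t ihs iht => simp only [subst, eval, ihs, iht]
  | mul s t ihs iht => simp only [subst, eval, ihs, iht]

@[simp]
theorem eval_lift (x : Fin n → M.Num) (a : M.Num) (t : Term n) :
    t.lift.eval M (Fin.cons a x : Fin (n + 1) → M.Num) = t.eval M x :=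
  eval_subst _ _ t

theorem eval_cons_lift (σ : Fin n → Term m) (x : Fin m → M.Num) (a : M.Num) :
    (fun i => eval M (Fin.cons a x : Fin (m + 1) → M.Num)
      ((Fin.cons (.var 0) fun i => (σ i).lift : Fin (n + 1) → Term (m + 1)) i)) =
      Fin.cons a fun i => (σ i).eval M x :=
  funext <| Fin.cases rfl fun i => eval_lift x a (σ i)

end Term

namespace Formula

variable {k n : ℕ}

theorem cons_comp_cons_succ {α : Type*} {k l : ℕ} (τ : Fin k → Fin l) (X : Fin l → α) (A : α) :
    (fun i => (Fin.cons A X : Fin (l + 1) → α)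
      ((Fin.cons 0 fun j => (τ j).succ : Fin (k + 1) → Fin (l + 1)) i)) =
      Fin.cons A fun i => X (τ i) :=
  funext <| Fin.cases rfl fun _ => rfl

theorem holds_subst (φ : Formula k n) {l m : ℕ} (τ : Fin k → Fin l) (σ : Fin n → Term m)
    (X : Fin l → M.Sets) (x : Fin m → M.Num) :
    (φ.subst τ σ).Holds M X x ↔ φ.Holds M (fun i => X (τ i)) fun i => (σ i).eval M x := by
  induction φ generalizing l m with
  | eq s t => simp only [subst, Holds, Term.eval_subst]
  | lt s t => simp only [subst, Holds, Term.eval_subst]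
  | mem t Y => simp only [subst, Holds, Term.eval_subst]
  | neg φ ih => simp only [subst, Holds, ih]
  | and φ ψ ihφ ihψ => simp only [subst, Holds, ihφ, ihψ]
  | or φ ψ ihφ ihψ => simp only [subst, Holds, ihφ, ihψ]
  | all φ ih => simp only [subst, Holds, ih, Term.eval_cons_lift]
  | ex φ ih => simp only [subst, Holds, ih, Term.eval_cons_lift]
  | allSet φ ih => simp only [subst, Holds, ih, cons_comp_cons_succ]
  | exSet φ ih => simp only [subst, Holds, ih, cons_comp_cons_succ]

variable (X : Fin k → M.Sets) (x : Fin n → M.Num)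

@[simp]
theorem holds_imp (φ ψ : Formula k n) :
    (imp φ ψ).Holds M X x ↔ (φ.Holds M X x → ψ.Holds M X x) :=
  imp_iff_not_or.symm

@[simp]
theorem holds_iff (φ ψ : Formula k n) :
    (iff φ ψ).Holds M X x ↔ (φ.Holds M X x ↔ ψ.Holds M X x) := by
  simp only [iff, Holds, holds_imp, iff_iff_implies_and_implies]

@[simp]
theorem holds_disj (L : List (Formula k n)) :
    (disj L).Holds M X x ↔ ∃ φ ∈ L, φ.Holds M X x := by
  induction L with
  | nil => simp [disj, Holds]
  | cons φ L ih => simp [disj, Holds, ih]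

@[simp]
theorem holds_exLT (t : Term n) (φ : Formula k (n + 1)) :
    (exLT t φ).Holds M X x ↔ ∃ a, M.lt a (t.eval M x) ∧ φ.Holds M X (Fin.cons a x) := by
  simp [exLT, Holds, Term.eval]

theorem holds_substZero (φ : Formula k (n + 1)) :
    φ.substZero.Holds M X x ↔ φ.Holds M X (Fin.cons M.zero x) := by
  have h : (fun i => ((Fin.cons .zero .var : Fin (n + 1) → Term n) i).eval M x) =
      Fin.cons M.zero x := funext <| Fin.cases rfl fun _ => rfl
  simp only [substZero, holds_subst, h, id]

theorem holds_substSucc (φ : Formula k (n + 1)) (a : M.Num) :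
    φ.substSucc.Holds M X (Fin.cons a x) ↔ φ.Holds M X (Fin.cons (M.succ a) x) := by
  have h : (fun i => ((Fin.cons (.succ (.var 0)) fun i => .var i.succ :
      Fin (n + 1) → Term (n + 1)) i).eval M (Fin.cons a x)) = Fin.cons (M.succ a) x :=
    funext <| Fin.cases rfl fun _ => rfl
  simp only [substSucc, holds_subst, h, id]

theorem holds_liftSet (φ : Formula k n) (A : M.Sets) :
    φ.liftSet.Holds M (Fin.cons A X) x ↔ φ.Holds M X x :=
  holds_subst φ Fin.succ .var _ x

theorem holds_closeNum (φ : Formula k n) :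
    φ.closeNum.Holds M X Fin.elim0 ↔ ∀ x, φ.Holds M X x := by
  induction n with
  | zero => exact ⟨fun h x => by rwa [Subsingleton.elim x Fin.elim0], fun h => h _⟩
  | succ n ih =>
    exact (ih φ.all).trans
      ⟨fun h x => Fin.cons_self_tail x ▸ h (Fin.tail x) (x 0), fun h _ _ => h _⟩

theorem satisfies_closeSet (φ : Formula k 0) :
    M.Satisfies φ.closeSet ↔ ∀ X, φ.Holds M X Fin.elim0 := by
  induction k with
  | zero => exact ⟨fun h X => by rwa [Subsingleton.elim X Fin.elim0], fun h => h _⟩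
  | succ k ih =>
    exact (ih φ.allSet).trans
      ⟨fun h X => Fin.cons_self_tail X ▸ h (Fin.tail X) (X 0), fun h _ _ => h _⟩

theorem satisfies_closure (φ : Formula k n) :
    M.Satisfies φ.closure ↔ ∀ X x, φ.Holds M X x := by
  simp only [closure, satisfies_closeSet, holds_closeNum]

end Formula

namespace Model

/-! ### Definability with parameters -/

instance : Zero M.Num := ⟨M.zero⟩
instance : One M.Num := ⟨M.succ M.zero⟩
instance : Add M.Num := ⟨M.add⟩
instance : Mul M.Num := ⟨M.mul⟩
instance : LT M.Num := ⟨M.lt⟩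
instance : Membership M.Num M.Sets := ⟨fun A a => M.mem a A⟩

/-- The functions given by terms with parameters from the structure. -/
inductive IsTermFun {n : ℕ} : ((Fin n → M.Num) → M.Num) → Prop
  | var (i : Fin n) : IsTermFun fun x => x i
  | const (a : M.Num) : IsTermFun fun _ => a
  | add {f g : (Fin n → M.Num) → M.Num} : IsTermFun f → IsTermFun g → IsTermFun fun x => f x + g x
  | mul {f g : (Fin n → M.Num) → M.Num} : IsTermFun f → IsTermFun g → IsTermFun fun x => f x * g x

/-- The relations defined by bounded formulas with number and set parameters. -/
inductive IsDelta0 : {n : ℕ} → ((Fin n → M.Num) → Prop) → Prop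
  | eq {n : ℕ} {f g : (Fin n → M.Num) → M.Num} :
      IsTermFun f → IsTermFun g → IsDelta0 fun x => f x = g x
  | lt {n : ℕ} {f g : (Fin n → M.Num) → M.Num} :
      IsTermFun f → IsTermFun g → IsDelta0 fun x => f x < g x
  | mem {n : ℕ} {f : (Fin n → M.Num) → M.Num} (hf : IsTermFun f) (A : M.Sets) :
      IsDelta0 fun x => f x ∈ A
  | not {n : ℕ} {P : (Fin n → M.Num) → Prop} : IsDelta0 P → IsDelta0 fun x => ¬P x
  | and {n : ℕ} {P Q : (Fin n → M.Num) → Prop} :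
      IsDelta0 P → IsDelta0 Q → IsDelta0 fun x => P x ∧ Q x
  | exLT {n : ℕ} {f : (Fin n → M.Num) → M.Num} {P : M.Num → (Fin n → M.Num) → Prop} :
      IsTermFun f → IsDelta0 (fun x : Fin (n + 1) → M.Num => P (x 0) (Fin.tail x)) →
        IsDelta0 fun x => ∃ a < f x, P a x

/-- The relations defined by `Σ⁰₁` formulas with number and set parameters. -/
inductive IsSigma1 : {n : ℕ} → ((Fin n → M.Num) → Prop) → Prop
  | delta0 {n : ℕ} {P : (Fin n → M.Num) → Prop} : IsDelta0 P → IsSigma1 P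
  | ex {n : ℕ} {P : M.Num → (Fin n → M.Num) → Prop} :
      IsSigma1 (fun x : Fin (n + 1) → M.Num => P (x 0) (Fin.tail x)) →
        IsSigma1 fun x => ∃ a, P a x

variable {n m : ℕ}

theorem IsTermFun.comp {f : (Fin n → M.Num) → M.Num} (hf : IsTermFun f)
    {σ : Fin n → (Fin m → M.Num) → M.Num} (hσ : ∀ i, IsTermFun (σ i)) :
    IsTermFun fun x => f fun i => σ i x := by
  induction hf with
  | var i => exact hσ i
  | const a => exact .const a
  | add _ _ ihf ihg => exact .add ihf ihg
  | mul _ _ ihf ihg => exact .mul ihf ihg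

theorem IsTermFun.comp_tail {f : (Fin n → M.Num) → M.Num} (hf : IsTermFun f) :
    IsTermFun fun x : Fin (n + 1) → M.Num => f (Fin.tail x) :=
  hf.comp fun i => .var i.succ

namespace IsDelta0

variable {f : (Fin n → M.Num) → M.Num} {P Q : (Fin n → M.Num) → Prop}

theorem congr (hP : IsDelta0 P) (h : ∀ x, Q x ↔ P x) : IsDelta0 Q :=
  (funext fun x => propext (h x) : Q = P) ▸ hP

theorem comp (hP : IsDelta0 P) {σ : Fin n → (Fin m → M.Num) → M.Num}
    (hσ : ∀ i, IsTermFun (σ i)) : IsDelta0 fun x => P fun i => σ i x := by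
  induction hP generalizing m with
  | eq hf hg => exact .eq (hf.comp hσ) (hg.comp hσ)
  | lt hf hg => exact .lt (hf.comp hσ) (hg.comp hσ)
  | mem hf A => exact .mem (hf.comp hσ) A
  | not _ ih => exact .not (ih hσ)
  | and _ _ ihP ihQ => exact .and (ihP hσ) (ihQ hσ)
  | exLT hf _ ih =>
    exact .exLT (hf.comp hσ) (ih (σ := Fin.cons (fun x => x 0) fun i x => σ i (Fin.tail x))
      (Fin.cases (.var 0) fun i => (hσ i).comp_tail))

theorem or (hP : IsDelta0 P) (hQ : IsDelta0 Q) : IsDelta0 fun x => P x ∨ Q x :=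
  (hP.not.and hQ.not).not.congr fun _ => or_iff_not_and_not

theorem imp (hP : IsDelta0 P) (hQ : IsDelta0 Q) : IsDelta0 fun x => P x → Q x :=
  (hP.not.or hQ).congr fun _ => imp_iff_not_or

theorem iff (hP : IsDelta0 P) (hQ : IsDelta0 Q) : IsDelta0 fun x => P x ↔ Q x :=
  ((hP.imp hQ).and (hQ.imp hP)).congr fun _ => iff_iff_implies_and_implies

theorem allLT {P : M.Num → (Fin n → M.Num) → Prop} (hf : IsTermFun f)
    (hP : IsDelta0 fun x : Fin (n + 1) → M.Num => P (x 0) (Fin.tail x)) :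
    IsDelta0 fun x => ∀ a < f x, P a x :=
  (IsDelta0.exLT (P := fun a x => ¬P a x) hf hP.not).not.congr fun _ => by simp

theorem const (p : Prop) : IsDelta0 fun _ : Fin n → M.Num => p := by
  have h : IsDelta0 fun _ : Fin n → M.Num => (0 : M.Num) = 0 := .eq (.const 0) (.const 0)
  by_cases hp : p
  · exact h.congr fun _ => iff_of_true hp rfl
  · exact h.not.congr fun _ => iff_of_false hp fun h => h rfl

theorem exists_finite {ι : Type*} [Finite ι] {P : ι → (Fin n → M.Num) → Prop}
    (hP : ∀ i, IsDelta0 (P i)) : IsDelta0 fun x => ∃ i, P i x := by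
  suffices h : ∀ s : Set ι, s.Finite → IsDelta0 fun x => ∃ i ∈ s, P i x from
    (h Set.univ Set.finite_univ).congr fun x => by simp
  intro s hs
  induction s, hs using Set.Finite.induction_on with
  | empty => exact (const False).congr fun x => by simp
  | @insert i _ _ _ ih => exact ((hP i).or ih).congr fun x => by simp

end IsDelta0

/-! ### Relations with parameters and formulas -/

/-- The functions `F` include all coordinate functions and all constants from `p`. Under the
assignment `fun j => F j x` to its variables, a formula can then speak about `x` and `p`. -/
def Supplies {l : ℕ} (F : Fin l → (Fin n → M.Num) → M.Num) (p : Finset M.Num) : Prop :=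
  (∀ i, ∃ j, F j = fun x => x i) ∧ ∀ a ∈ p, ∃ j, F j = fun _ => a

/-- The assignment `F`, extended by a bound variable with index `0`. -/
def extend {l : ℕ} (F : Fin l → (Fin n → M.Num) → M.Num) :
    Fin (l + 1) → (Fin (n + 1) → M.Num) → M.Num :=
  Fin.cons (fun x => x 0) fun j x => F j (Fin.tail x)

theorem extend_cons {l : ℕ} (F : Fin l → (Fin n → M.Num) → M.Num) (a : M.Num)
    (x : Fin n → M.Num) :
    (fun j => extend F j (Fin.cons a x)) = (Fin.cons a fun j => F j x : Fin (l + 1) → M.Num) :=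
  funext <| Fin.cases rfl fun _ => rfl

theorem supplies_extend {l : ℕ} {F : Fin l → (Fin n → M.Num) → M.Num} {p : Finset M.Num}
    (h : Supplies F p) : Supplies (extend F) p := by
  constructor
  · refine Fin.cases ⟨0, rfl⟩ fun i => ?_
    obtain ⟨j, hj⟩ := h.1 i
    exact ⟨j.succ, funext fun x => congrFun hj (Fin.tail x)⟩
  · intro a ha
    obtain ⟨j, hj⟩ := h.2 a ha
    exact ⟨j.succ, funext fun x => congrFun hj (Fin.tail x)⟩

theorem IsTermFun.eventually_exists_term {f : (Fin n → M.Num) → M.Num} (hf : IsTermFun f) :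
    ∀ᶠ p : Finset M.Num in atTop, ∀ {l : ℕ} (F : Fin l → (Fin n → M.Num) → M.Num), Supplies F p →
      ∃ t : Term l, ∀ x, t.eval M (fun j => F j x) = f x := by
  induction hf with
  | var i =>
    refine .of_forall fun p l F hF => ?_
    obtain ⟨j, hj⟩ := hF.1 i
    exact ⟨.var j, congrFun hj⟩
  | const a =>
    filter_upwards [eventually_ge_atTop {a}] with p hp l F hF
    obtain ⟨j, hj⟩ := hF.2 a (Finset.singleton_subset_iff.1 hp)
    exact ⟨.var j, congrFun hj⟩
  | add _ _ ihf ihg =>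
    filter_upwards [ihf, ihg] with p hf hg l F hF
    obtain ⟨s, hs⟩ := hf F hF
    obtain ⟨t, ht⟩ := hg F hF
    exact ⟨.add s t, fun x => congrArg₂ (· + ·) (hs x) (ht x)⟩
  | mul _ _ ihf ihg =>
    filter_upwards [ihf, ihg] with p hf hg l F hF
    obtain ⟨s, hs⟩ := hf F hF
    obtain ⟨t, ht⟩ := hg F hF
    exact ⟨.mul s t, fun x => congrArg₂ (· * ·) (hs x) (ht x)⟩

/-- `φ` defines the relation `P` under the assignments `X` and `fun j => F j x`. -/
def Expresses {k l : ℕ} (X : Fin k → M.Sets) (F : Fin l → (Fin n → M.Num) → M.Num)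
    (φ : Formula k l) (P : (Fin n → M.Num) → Prop) : Prop :=
  ∀ x, φ.Holds M X (fun j => F j x) ↔ P x

theorem IsDelta0.eventually_exists_formula {P : (Fin n → M.Num) → Prop} (hP : IsDelta0 P) :
    ∀ᶠ q : Finset M.Sets × Finset M.Num in atTop ×ˢ atTop,
      ∀ {k l : ℕ} (X : Fin k → M.Sets) (F : Fin l → (Fin n → M.Num) → M.Num),
        ↑q.1 ⊆ Set.range X → Supplies F q.2 →
          ∃ φ : Formula k l, φ.IsBounded ∧ Expresses X F φ P := by
  induction hP with
  | eq hf hg =>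
    filter_upwards [hf.eventually_exists_term.prod_inr _, hg.eventually_exists_term.prod_inr _]
      with q hf hg k l X F _ hF
    obtain ⟨s, hs⟩ := hf F hF
    obtain ⟨t, ht⟩ := hg F hF
    exact ⟨.eq s t, .eq s t, fun x => by rw [Formula.Holds, hs, ht]⟩
  | lt hf hg =>
    filter_upwards [hf.eventually_exists_term.prod_inr _, hg.eventually_exists_term.prod_inr _]
      with q hf hg k l X F _ hF
    obtain ⟨s, hs⟩ := hf F hF
    obtain ⟨t, ht⟩ := hg F hF
    exact ⟨.lt s t, .lt s t, fun x => by rw [Formula.Holds, hs, ht]; rfl⟩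
  | mem hf A =>
    filter_upwards [(eventually_ge_atTop {A}).prod_inl _, hf.eventually_exists_term.prod_inr _]
      with q hA hf k l X F hX hF
    obtain ⟨i, rfl⟩ := hX (Finset.singleton_subset_iff.1 hA)
    obtain ⟨t, ht⟩ := hf F hF
    exact ⟨.mem t i, .mem t i, fun x => by rw [Formula.Holds, ht]; rfl⟩
  | not _ ih =>
    filter_upwards [ih] with q h k l X F hX hF
    obtain ⟨φ, hφ, h⟩ := h X F hX hF
    exact ⟨.neg φ, .neg hφ, fun x => not_congr (h x)⟩
  | and _ _ ihP ihQ =>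
    filter_upwards [ihP, ihQ] with q hP hQ k l X F hX hF
    obtain ⟨φ, hφ, hP⟩ := hP X F hX hF
    obtain ⟨ψ, hψ, hQ⟩ := hQ X F hX hF
    exact ⟨.and φ ψ, .and hφ hψ, fun x => and_congr (hP x) (hQ x)⟩
  | exLT hf _ ih =>
    filter_upwards [hf.eventually_exists_term.prod_inr _, ih] with q hf h k l X F hX hF
    obtain ⟨t, ht⟩ := hf F hF
    obtain ⟨φ, hφ, h⟩ := h X (extend F) hX (supplies_extend hF)
    refine ⟨.exLT t φ, .exLT t hφ, fun x => ?_⟩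
    simp only [Formula.holds_exLT, ht, ← extend_cons, h _]
    rfl

theorem IsSigma1.eventually_exists_formula {P : (Fin n → M.Num) → Prop} (hP : IsSigma1 P) :
    ∀ᶠ q : Finset M.Sets × Finset M.Num in atTop ×ˢ atTop,
      ∀ {k l : ℕ} (X : Fin k → M.Sets) (F : Fin l → (Fin n → M.Num) → M.Num),
        ↑q.1 ⊆ Set.range X → Supplies F q.2 →
          ∃ φ : Formula k l, φ.IsSigma1 ∧ Expresses X F φ P := by
  induction hP with
  | delta0 h =>
    filter_upwards [h.eventually_exists_formula] with q h k l X F hX hF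
    obtain ⟨φ, hφ, h⟩ := h X F hX hF
    exact ⟨φ, .bounded hφ, h⟩
  | ex _ ih =>
    filter_upwards [ih] with q h k l X F hX hF
    obtain ⟨φ, hφ, h⟩ := h X (extend F) hX (supplies_extend hF)
    refine ⟨.ex φ, .ex hφ, fun x => exists_congr fun a => ?_⟩
    rw [← extend_cons]
    exact h _

/-- The structure satisfies the axioms of `RCA₀`, where each scheme is stated for the relations
definable with parameters instead of for formulas. -/
class IsRCA (M : Model.{u, v}) : Prop where
  succ_eq_add_one (a : M.Num) : M.succ a = a + 1
  add_one_ne_zero (a : M.Num) : a + 1 ≠ 0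
  add_one_injective : Function.Injective fun a : M.Num => a + 1
  protected add_zero (a : M.Num) : a + 0 = a
  add_add_one (a b : M.Num) : a + (b + 1) = a + b + 1
  protected mul_zero (a : M.Num) : a * 0 = 0
  protected mul_add_one (a b : M.Num) : a * (b + 1) = a * b + a
  lt_iff (a b : M.Num) : a < b ↔ ∃ c, a + (c + 1) = b
  sigma1_induction {P : M.Num → Prop} (hP : IsSigma1 fun x : Fin 1 → M.Num => P (x 0))
    (zero : P 0) (add_one : ∀ a, P a → P (a + 1)) (a : M.Num) : P a
  delta1_comprehension {P Q : M.Num → Prop} (hP : IsSigma1 fun x : Fin 1 → M.Num => P (x 0))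
    (hQ : IsSigma1 fun x : Fin 1 → M.Num => Q (x 0)) (hPQ : ∀ a, P a ↔ ¬Q a) :
    ∃ A : M.Sets, ∀ a, a ∈ A ↔ P a

theorem exists_sigma1_formulas {P Q : M.Num → Prop}
    (hP : IsSigma1 fun x : Fin 1 → M.Num => P (x 0))
    (hQ : IsSigma1 fun x : Fin 1 → M.Num => Q (x 0)) :
    ∃ (k l : ℕ) (X : Fin k → M.Sets) (y : Fin l → M.Num) (φ ψ : Formula k (l + 1)),
      (φ.IsSigma1 ∧ ∀ a, φ.Holds M X (Fin.cons a y) ↔ P a) ∧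
        (ψ.IsSigma1 ∧ ∀ a, ψ.Holds M X (Fin.cons a y) ↔ Q a) := by
  classical
  obtain ⟨⟨A, p⟩, hP, hQ⟩ :=
    (hP.eventually_exists_formula.and hQ.eventually_exists_formula).exists
  obtain ⟨k, X, -, hX⟩ := A.finite_toSet.fin_param
  obtain ⟨l, y, -, hy⟩ := p.finite_toSet.fin_param
  let F : Fin (l + 1) → (Fin 1 → M.Num) → M.Num := Fin.cons (fun x => x 0) fun j _ => y j
  have eval_F (x : Fin 1 → M.Num) : (fun j => F j x) = Fin.cons (x 0) y :=
    funext <| Fin.cases rfl fun _ => rfl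
  have supplies_F : Supplies F p := by
    refine ⟨fun i => ⟨0, by rw [Subsingleton.elim i 0]; rfl⟩, fun a ha => ?_⟩
    obtain ⟨j, rfl⟩ := hy.ge ha
    exact ⟨j.succ, rfl⟩
  obtain ⟨φ, hφ, hP⟩ := hP X F hX.ge supplies_F
  obtain ⟨ψ, hψ, hQ⟩ := hQ X F hX.ge supplies_F
  simp only [Expresses, eval_F] at hP hQ
  exact ⟨k, l, X, y, φ, ψ, ⟨hφ, fun a => hP fun _ => a⟩, hψ, fun a => hQ fun _ => a⟩

theorem sigma1_induction_of_satisfies (h : ∀ χ ∈ RCA₀, M.Satisfies χ) {P : M.Num → Prop}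
    (hP : IsSigma1 fun x : Fin 1 → M.Num => P (x 0)) (zero : P 0)
    (succ : ∀ a, P a → P (M.succ a)) (a : M.Num) : P a := by
  obtain ⟨k, l, X, y, φ, -, ⟨hφ, hP⟩, -⟩ := exists_sigma1_formulas hP hP
  have induction := h _ (.inl (.inr ⟨k, l, φ, hφ, rfl⟩))
  simp only [Formula.induction, Formula.satisfies_closure, Formula.holds_imp, Formula.Holds,
    Formula.holds_substZero, Formula.holds_substSucc] at induction
  have induction_P := induction X y
  simp only [hP] at induction_P
  exact induction_P ⟨zero, succ⟩ a

theorem delta1_comprehension_of_satisfies (h : ∀ χ ∈ RCA₀, M.Satisfies χ) {P Q : M.Num → Prop}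
    (hP : IsSigma1 fun x : Fin 1 → M.Num => P (x 0))
    (hQ : IsSigma1 fun x : Fin 1 → M.Num => Q (x 0)) (hPQ : ∀ a, P a ↔ ¬Q a) :
    ∃ A : M.Sets, ∀ a, a ∈ A ↔ P a := by
  obtain ⟨k, l, X, y, φ, ψ, ⟨hφ, hP⟩, hψ, hQ⟩ := exists_sigma1_formulas hP hQ
  have comprehension := h _ (.inr ⟨k, l, φ, ψ, hφ, hψ, rfl⟩)
  simp only [Formula.comprehension, Formula.satisfies_closure, Formula.holds_imp, Formula.Holds,
    Formula.holds_iff, Formula.holds_liftSet] at comprehension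
  have comprehension_P := comprehension X y
  simp only [hP, hQ] at comprehension_P
  exact comprehension_P hPQ

theorem isRCA_of_satisfies (h : ∀ χ ∈ RCA₀, M.Satisfies χ) : M.IsRCA := by
  have robinson_axioms : ∀ χ ∈ robinson, M.Satisfies χ := fun χ hχ => h χ (.inl (.inl hχ))
  simp only [robinson, Set.mem_insert_iff, Set.mem_singleton_iff, forall_eq_or_imp, forall_eq,
    Satisfies, Formula.Holds, Formula.holds_imp, Formula.holds_iff, Term.eval] at robinson_axioms
  obtain ⟨succ_ne_zero, succ_inj, -, add_zero, add_succ, mul_zero, mul_succ, lt_iff⟩ :=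
    robinson_axioms
  have succ_eq (a : M.Num) : M.succ a = a + 1 :=
    ((add_succ a M.zero).trans (congrArg M.succ (add_zero a))).symm
  refine
    { succ_eq_add_one := succ_eq
      add_one_ne_zero := fun a => succ_eq a ▸ succ_ne_zero a
      add_one_injective := fun a b => by simp only [← succ_eq]; exact succ_inj a b
      add_zero := add_zero
      add_add_one := fun a b => by simp only [← succ_eq]; exact add_succ a b
      mul_zero := mul_zero
      mul_add_one := fun a b => by simp only [← succ_eq]; exact mul_succ a b
      lt_iff := fun a b => by simp only [← succ_eq]; exact lt_iff a b
      sigma1_induction := fun hP zero add_one =>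
        sigma1_induction_of_satisfies h hP zero fun a => succ_eq a ▸ add_one a
      delta1_comprehension := delta1_comprehension_of_satisfies h }

variable [M.IsRCA]

/-! ### Arithmetic in models of `RCA₀` -/

theorem delta0_induction {P : M.Num → Prop} (hP : IsDelta0 fun x : Fin 1 → M.Num => P (x 0))
    (zero : P 0) (add_one : ∀ a, P a → P (a + 1)) : ∀ a, P a :=
  IsRCA.sigma1_induction (.delta0 hP) zero add_one

protected theorem IsRCA.zero_add : ∀ a : M.Num, 0 + a = a :=
  delta0_induction (.eq (.add (.const 0) (.var 0)) (.var 0)) (IsRCA.add_zero 0) fun a h => by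
    rw [IsRCA.add_add_one, h]

protected theorem IsRCA.add_one_add (b : M.Num) : ∀ a, b + 1 + a = b + a + 1 :=
  delta0_induction (.eq (.add (.const _) (.var 0)) (.add (.add (.const b) (.var 0)) (.const 1)))
    (by rw [IsRCA.add_zero, IsRCA.add_zero]) fun a h => by
      rw [IsRCA.add_add_one, h, IsRCA.add_add_one]

protected theorem IsRCA.add_comm (b : M.Num) : ∀ a, a + b = b + a :=
  delta0_induction (.eq (.add (.var 0) (.const b)) (.add (.const b) (.var 0)))
    (by rw [IsRCA.zero_add, IsRCA.add_zero]) fun a h => by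
      rw [IsRCA.add_one_add, h, IsRCA.add_add_one]

protected theorem IsRCA.add_assoc (b c : M.Num) : ∀ a, b + c + a = b + (c + a) :=
  delta0_induction (.eq (.add (.const _) (.var 0)) (.add (.const b) (.add (.const c) (.var 0))))
    (by rw [IsRCA.add_zero, IsRCA.add_zero]) fun a h => by
      rw [IsRCA.add_add_one, h, IsRCA.add_add_one, IsRCA.add_add_one]

instance : AddCommMonoid M.Num where
  add_assoc a b := IsRCA.add_assoc a b
  zero_add := IsRCA.zero_add
  add_zero := IsRCA.add_zero
  add_comm a b := IsRCA.add_comm b a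
  nsmul := nsmulRec

protected theorem IsRCA.zero_mul : ∀ a : M.Num, 0 * a = 0 :=
  delta0_induction (.eq (.mul (.const 0) (.var 0)) (.const 0)) (IsRCA.mul_zero 0) fun a h => by
    rw [IsRCA.mul_add_one, h, add_zero]

protected theorem IsRCA.add_one_mul (b : M.Num) : ∀ a, (b + 1) * a = b * a + a :=
  delta0_induction (.eq (.mul (.const _) (.var 0)) (.add (.mul (.const b) (.var 0)) (.var 0)))
    (by rw [IsRCA.mul_zero, IsRCA.mul_zero, add_zero]) fun a h => by
      rw [IsRCA.mul_add_one, h, IsRCA.mul_add_one]; abel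

protected theorem IsRCA.mul_comm (b : M.Num) : ∀ a, a * b = b * a :=
  delta0_induction (.eq (.mul (.var 0) (.const b)) (.mul (.const b) (.var 0)))
    (by rw [IsRCA.zero_mul, IsRCA.mul_zero]) fun a h => by
      rw [IsRCA.add_one_mul, h, IsRCA.mul_add_one]

protected theorem IsRCA.mul_add (b c : M.Num) : ∀ a, b * (c + a) = b * c + b * a :=
  delta0_induction (.eq (.mul (.const b) (.add (.const c) (.var 0)))
      (.add (.const _) (.mul (.const b) (.var 0))))
    (by rw [IsRCA.mul_zero, add_zero, add_zero]) fun a h => by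
      rw [← add_assoc, IsRCA.mul_add_one, h, IsRCA.mul_add_one, add_assoc]

protected theorem IsRCA.mul_assoc (b c : M.Num) : ∀ a, b * c * a = b * (c * a) :=
  delta0_induction (.eq (.mul (.const _) (.var 0)) (.mul (.const b) (.mul (.const c) (.var 0))))
    (by rw [IsRCA.mul_zero, IsRCA.mul_zero, IsRCA.mul_zero]) fun a h => by
      rw [IsRCA.mul_add_one, h, IsRCA.mul_add_one, IsRCA.mul_add]

protected theorem IsRCA.mul_one (a : M.Num) : a * 1 = a := by
  rw [← zero_add (1 : M.Num), IsRCA.mul_add_one, IsRCA.mul_zero, zero_add]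

instance : CommSemiring M.Num where
  left_distrib a b c := IsRCA.mul_add a b c
  right_distrib a b c := by
    rw [IsRCA.mul_comm c, IsRCA.mul_add, IsRCA.mul_comm a, IsRCA.mul_comm b]
  zero_mul := IsRCA.zero_mul
  mul_zero := IsRCA.mul_zero
  mul_assoc a b := IsRCA.mul_assoc a b
  one_mul a := (IsRCA.mul_comm a 1).trans (IsRCA.mul_one a)
  mul_one := IsRCA.mul_one
  mul_comm a b := IsRCA.mul_comm b a

protected theorem IsRCA.exists_eq_add_one {a : M.Num} (ha : a ≠ 0) : ∃ b, a = b + 1 := by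
  have zero_or_succ := IsRCA.sigma1_induction (P := fun a : M.Num => ∃ b, a ≠ 0 → a = b + 1)
    (.ex (.delta0 (.imp (.not (.eq (.var 1) (.const 0)))
      (.eq (.var 1) (.add (.var 0) (.const 1))))))
    ⟨0, fun h => absurd rfl h⟩ fun a _ => ⟨a, fun _ => rfl⟩
  exact (zero_or_succ a).imp fun b hb => hb ha

protected theorem IsRCA.add_left_cancel (b c : M.Num) : ∀ a, a + b = a + c → b = c :=
  delta0_induction
    (.imp (.eq (.add (.var 0) (.const b)) (.add (.var 0) (.const c))) (.const (b = c)))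
    (by simp only [zero_add, imp_self]) fun a ih h => by
      exact ih (IsRCA.add_one_injective (by simpa only [add_right_comm] using h))

protected theorem IsRCA.eq_zero_of_add_eq_zero {a b : M.Num} (h : a + b = 0) : a = 0 := by
  by_contra ha
  obtain ⟨c, rfl⟩ := IsRCA.exists_eq_add_one ha
  exact IsRCA.add_one_ne_zero (c + b) (by rw [add_right_comm, h])

protected theorem IsRCA.exists_add_or_exists_add (b a : M.Num) :
    (∃ c, b = a + c) ∨ ∃ c, a = b + c := by
  rw [← exists_or]
  refine IsRCA.sigma1_induction (P := fun a => ∃ c, b = a + c ∨ a = b + c)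
    (.ex (.delta0 (.or (.eq (.const b) (.add (.var 1) (.var 0)))
      (.eq (.var 1) (.add (.const b) (.var 0)))))) ⟨b, .inl (zero_add b).symm⟩ ?_ a
  rintro a ⟨c, rfl | rfl⟩
  · obtain rfl | hc := eq_or_ne c 0
    · exact ⟨1, .inr (by rw [add_zero])⟩
    · obtain ⟨d, rfl⟩ := IsRCA.exists_eq_add_one hc
      exact ⟨d, .inl (by ring)⟩
  · exact ⟨c + 1, .inr (add_assoc b c 1)⟩

noncomputable instance : LinearOrder M.Num where
  le a b := ∃ c, b = a + c
  lt := (· < ·)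
  le_refl a := ⟨0, (add_zero a).symm⟩
  le_trans := by
    rintro a _ _ ⟨b, rfl⟩ ⟨c, rfl⟩
    exact ⟨b + c, add_assoc a b c⟩
  le_antisymm := by
    rintro a _ ⟨c, rfl⟩ ⟨d, h⟩
    have hcd : c + d = 0 := IsRCA.add_left_cancel _ _ a (by rw [← add_assoc, ← h, add_zero])
    rw [IsRCA.eq_zero_of_add_eq_zero hcd, add_zero]
  le_total a b := IsRCA.exists_add_or_exists_add b a
  lt_iff_le_not_ge a b := by
    rw [IsRCA.lt_iff]
    constructor
    · rintro ⟨c, rfl⟩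
      refine ⟨⟨c + 1, rfl⟩, fun ⟨d, h⟩ => IsRCA.add_one_ne_zero (c + d) ?_⟩
      exact IsRCA.add_left_cancel _ _ a (by rw [add_zero]; exact .trans (by ring) h.symm)
    · rintro ⟨⟨c, rfl⟩, h⟩
      obtain rfl | hc := eq_or_ne c 0
      · exact absurd ⟨0, by rw [add_zero, add_zero]⟩ h
      · obtain ⟨d, rfl⟩ := IsRCA.exists_eq_add_one hc
        exact ⟨d, rfl⟩
  toDecidableLE := Classical.decRel _

instance : CanonicallyOrderedAdd M.Num where
  exists_add_of_le := id
  le_add_self a b := ⟨b, add_comm b a⟩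
  le_self_add _ b := ⟨b, rfl⟩

protected theorem IsRCA.mul_lt_mul_left {a b c : M.Num} (hc : 0 < c) (hab : a < b) :
    c * a < c * b := by
  obtain ⟨d, rfl⟩ := (IsRCA.lt_iff ..).1 hc
  obtain ⟨e, rfl⟩ := (IsRCA.lt_iff ..).1 hab
  exact (IsRCA.lt_iff ..).2 ⟨d * e + d + e, by ring⟩

instance : Nontrivial M.Num := ⟨0 + 1, 0, IsRCA.add_one_ne_zero 0⟩

instance : IsStrictOrderedRing M.Num where
  add_le_add_left _ _ h c := add_le_add_left h c
  le_of_add_le_add_left a _ _ := by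
    rintro ⟨d, h⟩
    exact ⟨d, IsRCA.add_left_cancel _ _ a (h.trans (add_assoc ..))⟩
  zero_le_one := zero_le
  mul_lt_mul_of_pos_left _ hc _ _ h := IsRCA.mul_lt_mul_left hc h
  mul_lt_mul_of_pos_right c hc a b h := by
    simpa only [mul_comm _ c] using IsRCA.mul_lt_mul_left hc h

noncomputable instance : SuccAddOrder M.Num where
  __ := SuccOrder.ofSuccLeIff (· + 1) fun {a b} => by
    rw [IsRCA.lt_iff]
    exact exists_congr fun c => by rw [eq_comm, add_comm c, add_assoc]
  succ_eq_add_one _ := rfl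

theorem eval_numeral {n : ℕ} (x : Fin n → M.Num) (m : ℕ) :
    (Term.numeral m : Term n).eval M x = (m : M.Num) := by
  induction m with
  | zero => exact Nat.cast_zero.symm
  | succ m ih => rw [Term.numeral, Term.eval, ih, IsRCA.succ_eq_add_one, Nat.cast_succ]

theorem exists_natCast_eq_of_lt {m : ℕ} {a : M.Num} (h : a < m) : ∃ i : Fin m, (i : ℕ) = a := by
  induction m with
  | zero => simp at h
  | succ m ih =>
    rw [Nat.cast_succ, Order.lt_add_one_iff] at h
    obtain rfl | h := h.eq_or_lt
    · exact ⟨Fin.last m, rfl⟩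
    · obtain ⟨i, rfl⟩ := ih h
      exact ⟨i.castSucc, rfl⟩

end Model

/-! ### Codes for finite sets -/

section Modulus

variable {R : Type*} [CommSemiring R] {a b c d x y : R}

/-- The moduli `1 + (x + 1) b` of Gödel's beta function, which are pairwise coprime for `x < n`
when `b` is divisible by all differences of such `x`. -/
def modulus (b x : R) : R := 1 + (x + 1) * b

/-- The number `x` belongs to the finite set with the code `(b, c)`. -/
def InCode (b c x : R) : Prop := modulus b x ∣ c

variable [LinearOrder R] [CanonicallyOrderedAdd R] [IsCancelAdd R]

theorem dvd_right_of_dvd_add (ha : d ∣ a) (h : d ∣ a + b) : d ∣ b := by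
  obtain ⟨p, rfl⟩ := ha
  obtain ⟨q, hq⟩ := h
  obtain hpq | hqp := le_total p q
  · obtain ⟨r, rfl⟩ := exists_add_of_le hpq
    exact ⟨r, add_left_cancel (hq.trans (mul_add d p r))⟩
  · obtain ⟨r, rfl⟩ := exists_add_of_le hqp
    have hb : d * r + b = 0 := add_left_cancel (a := d * q)
      (by rw [← add_assoc, ← mul_add, hq, add_zero])
    rw [(add_eq_zero.1 hb).2]
    exact dvd_zero d

theorem dvd_of_modulus_dvd_mul_self (h : modulus b x ∣ c * b) : modulus b x ∣ c :=
  dvd_right_of_dvd_add (h.mul_left (x + 1)) ⟨c, by rw [modulus]; ring⟩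

theorem InCode.of_mul_modulus (hd : d ∣ b) (hxy : y = x + d ∨ x = y + d)
    (h : InCode b (c * modulus b y) x) : InCode b c x := by
  have dvd_mul_sub : modulus b x ∣ c * d * b := by
    obtain rfl | rfl := hxy
    · refine dvd_right_of_dvd_add (Dvd.intro_left c rfl) (h.trans (dvd_of_eq ?_))
      simp only [modulus]
      ring
    · refine dvd_right_of_dvd_add h (Dvd.intro_left c ?_)
      simp only [modulus]
      ring
  exact dvd_of_modulus_dvd_mul_self
    ((dvd_of_modulus_dvd_mul_self dvd_mul_sub).trans (mul_dvd_mul_left c hd))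

end Modulus

namespace Model

variable [M.IsRCA] {n : ℕ}

theorem dvd_iff_exists_lt {a b : M.Num} : a ∣ b ↔ ∃ q < b + 1, b = a * q := by
  refine ⟨?_, fun ⟨q, _, hq⟩ => ⟨q, hq⟩⟩
  rintro ⟨q, rfl⟩
  obtain rfl | ha := eq_or_ne a 0
  · exact ⟨0, by simp⟩
  · exact ⟨q, Order.lt_add_one_iff.2 (le_mul_of_one_le_left zero_le
      (Order.one_le_iff_pos.2 ha.pos)), rfl⟩

theorem IsDelta0.dvd {f g : (Fin n → M.Num) → M.Num} (hf : IsTermFun f) (hg : IsTermFun g) :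
    IsDelta0 fun x => f x ∣ g x :=
  (IsDelta0.exLT (.add hg (.const 1)) (.eq hg.comp_tail
    (.mul hf.comp_tail (.var 0)))).congr fun _ => dvd_iff_exists_lt

theorem IsDelta0.inCode {f g h : (Fin n → M.Num) → M.Num} (hf : IsTermFun f) (hg : IsTermFun g)
    (hh : IsTermFun h) : IsDelta0 fun x => InCode (f x) (g x) (h x) :=
  .dvd (.add (.const 1) (.mul (.add hh (.const 1)) hf)) hg

theorem not_inCode_one {b x : M.Num} (hb : b ≠ 0) : ¬InCode b 1 x := by
  rintro ⟨q, hq⟩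
  have hq0 : q ≠ 0 := by
    rintro rfl
    simp at hq
  have le_one : modulus b x ≤ 1 :=
    (le_mul_of_one_le_right zero_le (Order.one_le_iff_pos.2 hq0.pos)).trans_eq hq.symm
  have one_lt : 1 < modulus b x := lt_add_of_pos_right 1 (mul_pos (by positivity) hb.pos)
  exact one_lt.not_ge le_one

theorem exists_common_multiple (n : M.Num) : ∃ b ≠ 0, ∀ x < n, x + 1 ∣ b := by
  revert n
  refine IsRCA.sigma1_induction (P := fun n => ∃ b : M.Num, b ≠ 0 ∧ ∀ x < n, x + 1 ∣ b)
    (.ex (.delta0 (.and (.not (.eq (.var 0) (.const 0)))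
      (.allLT (.var 1) (.dvd (.add (.var 0) (.const 1)) (.var 1))))))
    ⟨1, one_ne_zero, fun x hx => absurd hx not_lt_zero⟩ ?_
  rintro n ⟨b, hb, h⟩
  refine ⟨b * (n + 1), mul_ne_zero hb (IsRCA.add_one_ne_zero n), fun x hx => ?_⟩
  obtain rfl | hx := (Order.lt_add_one_iff.1 hx).eq_or_lt
  · exact dvd_mul_left _ _
  · exact (h x hx).mul_right _

theorem inCode_mul_modulus {b c n x y : M.Num} (hb : ∀ z < n, z + 1 ∣ b) (hx : x < n) (hy : y < n) :
    InCode b (c * modulus b y) x ↔ InCode b c x ∨ x = y := by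
  have exists_difference {y z : M.Num} (hyz : y < z) (hz : z < n) : ∃ d, d ∣ b ∧ z = y + d := by
    obtain ⟨e, rfl⟩ := (IsRCA.lt_iff y z).1 hyz
    exact ⟨e + 1, hb e ((Order.lt_add_one_iff.2 le_rfl).trans_le le_add_self |>.trans hz), rfl⟩
  constructor
  · refine fun h => or_iff_not_imp_right.2 fun hxy => ?_
    obtain hlt | hlt := Ne.lt_or_gt hxy
    · obtain ⟨d, hd, hxy⟩ := exists_difference hlt hy
      exact h.of_mul_modulus hd (.inl hxy)
    · obtain ⟨d, hd, hxy⟩ := exists_difference hlt hx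
      exact h.of_mul_modulus hd (.inr hxy)
  · rintro (h | rfl)
    · exact h.mul_right _
    · exact dvd_mul_left _ _

theorem exists_code (A : M.Sets) (n : M.Num) :
    ∃ b c : M.Num, ∀ x < n, InCode b c x ↔ x ∈ A := by
  obtain ⟨b, hb0, hb⟩ := exists_common_multiple n
  suffices h : ∀ k, ∃ c, ∀ x < n, InCode b c x ↔ x < k ∧ x ∈ A by
    obtain ⟨c, hc⟩ := h n
    exact ⟨b, c, fun x hx => (hc x hx).trans (and_iff_right hx)⟩
  refine IsRCA.sigma1_induction (P := fun k => ∃ c, ∀ x < n, InCode b c x ↔ x < k ∧ x ∈ A)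
    (.ex (.delta0 (.allLT (.const n) (.iff (.inCode (.const b) (.var 1) (.var 0))
      (.and (.lt (.var 0) (.var 2)) (.mem (.var 0) A))))))
    ⟨1, fun x _ => iff_of_false (not_inCode_one hb0) fun h => not_lt_zero h.1⟩ ?_
  rintro k ⟨c, hc⟩
  by_cases hk : k < n ∧ k ∈ A
  · refine ⟨c * modulus b k, fun x hx => ?_⟩
    rw [inCode_mul_modulus hb hx hk.1, hc x hx, Order.lt_add_one_iff, le_iff_lt_or_eq]
    grind
  · refine ⟨c, fun x hx => ?_⟩
    rw [hc x hx, Order.lt_add_one_iff, le_iff_lt_or_eq]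
    grind

/-! ### Recursion for sets -/

theorem delta0_comprehension {P : M.Num → Prop}
    (hP : IsDelta0 fun x : Fin 1 → M.Num => P (x 0)) : ∃ A : M.Sets, ∀ a, a ∈ A ↔ P a :=
  IsRCA.delta1_comprehension (.delta0 hP) (.delta0 hP.not) fun _ => not_not.symm

theorem delta0_strong_induction {P : M.Num → Prop}
    (hP : IsDelta0 fun x : Fin 1 → M.Num => P (x 0)) (h : ∀ a, (∀ b < a, P b) → P a) (a : M.Num) :
    P a := by
  obtain ⟨A, hA⟩ := delta0_comprehension hP
  refine h a (delta0_induction (P := fun a => ∀ b < a, P b) ?_ (fun b hb => absurd hb not_lt_zero)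
    (fun a ih b hb => ?_) a)
  · simp only [← hA]
    exact .allLT (.var 0) (.mem (.var 0) A)
  · obtain rfl | hb := (Order.lt_add_one_iff.1 hb).eq_or_lt
    · exact h b ih
    · exact ih b hb

variable {Φ : M.Num → (M.Num → Prop) → Prop}

/-- `p` is a solution of the recursion `p x ↔ Φ x p` below `n`. -/
def SolvesBelow (Φ : M.Num → (M.Num → Prop) → Prop) (n : M.Num) (p : M.Num → Prop) : Prop :=
  ∀ x < n, p x ↔ Φ x p

theorem SolvesBelow.congr {n : M.Num} {p q : M.Num → Prop}
    (local_Φ : ∀ x p q, (∀ y < x, p y ↔ q y) → (Φ x p ↔ Φ x q)) (hp : SolvesBelow Φ n p)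
    (hpq : ∀ x < n, p x ↔ q x) : SolvesBelow Φ n q := fun x hx =>
  (hpq x hx).symm.trans <| (hp x hx).trans <| local_Φ x p q fun y hy => hpq y (hy.trans hx)

theorem SolvesBelow.inCode_unique {n b c b' c' : M.Num}
    (local_Φ : ∀ x p q, (∀ y < x, p y ↔ q y) → (Φ x p ↔ Φ x q))
    (h : SolvesBelow Φ n (InCode b c)) (h' : SolvesBelow Φ n (InCode b' c')) :
    ∀ x < n, InCode b c x ↔ InCode b' c' x := by
  refine delta0_strong_induction (P := fun x => x < n → (InCode b c x ↔ InCode b' c' x))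
    (.imp (.lt (.var 0) (.const n)) (.iff (.inCode (.const b) (.const c) (.var 0))
      (.inCode (.const b') (.const c') (.var 0)))) fun x ih hx => ?_
  rw [h x hx, h' x hx]
  exact local_Φ x _ _ fun y hy => ih y hy (hy.trans hx)

theorem IsDelta0.solvesBelow
    (delta0_Φ : IsDelta0 fun v : Fin 3 → M.Num => Φ (v 0) (InCode (v 1) (v 2))) {n : ℕ}
    {f g h : (Fin n → M.Num) → M.Num} (hf : IsTermFun f) (hg : IsTermFun g) (hh : IsTermFun h) :
    IsDelta0 fun x => SolvesBelow Φ (f x) (InCode (g x) (h x)) :=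
  .allLT hf <| .iff (.inCode hg.comp_tail hh.comp_tail (.var 0)) <|
    delta0_Φ.comp (σ := ![fun x => x 0, fun x => g (Fin.tail x), fun x => h (Fin.tail x)]) <|
      Fin.cases (.var 0) <| Fin.cases hg.comp_tail <| Fin.cases hh.comp_tail fun i => i.elim0

theorem exists_solvesBelow (local_Φ : ∀ x p q, (∀ y < x, p y ↔ q y) → (Φ x p ↔ Φ x q))
    (delta0_Φ : IsDelta0 fun v : Fin 3 → M.Num => Φ (v 0) (InCode (v 1) (v 2))) (n : M.Num) :
    ∃ b c, SolvesBelow Φ n (InCode b c) := by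
  revert n
  refine IsRCA.sigma1_induction
    (.ex (.ex (.delta0 (.solvesBelow delta0_Φ (.var 2) (.var 1) (.var 0)))))
    ⟨0, 0, fun x hx => absurd hx not_lt_zero⟩ ?_
  rintro n ⟨b, c, hbc⟩
  obtain ⟨A, hA⟩ := delta0_comprehension
    (P := fun x => x < n ∧ InCode b c x ∨ x = n ∧ Φ n (InCode b c))
    (.or (.and (.lt (.var 0) (.const n)) (.inCode (.const b) (.const c) (.var 0)))
      (.and (.eq (.var 0) (.const n)) (.const _)))
  have mem_A_of_lt {x : M.Num} (hx : x < n) : x ∈ A ↔ InCode b c x := by simp [hA, hx, hx.ne]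
  have n_mem_A : n ∈ A ↔ Φ n (InCode b c) := by simp [hA]
  have solves_A : SolvesBelow Φ (n + 1) (· ∈ A) := by
    intro x hx
    obtain rfl | hx := (Order.lt_add_one_iff.1 hx).eq_or_lt
    · exact n_mem_A.trans (local_Φ x _ _ fun y hy => (mem_A_of_lt hy).symm)
    · exact hbc.congr local_Φ (fun y hy => (mem_A_of_lt hy).symm) x hx
  obtain ⟨b', c', hA'⟩ := exists_code A (n + 1)
  exact ⟨b', c', solves_A.congr local_Φ fun x hx => (hA' x hx).symm⟩

theorem exists_set_of_recursion (local_Φ : ∀ x p q, (∀ y < x, p y ↔ q y) → (Φ x p ↔ Φ x q))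
    (delta0_Φ : IsDelta0 fun v : Fin 3 → M.Num => Φ (v 0) (InCode (v 1) (v 2))) :
    ∃ G : M.Sets, ∀ x, x ∈ G ↔ Φ x (· ∈ G) := by
  have solution := exists_solvesBelow local_Φ delta0_Φ
  obtain ⟨G, hG⟩ := IsRCA.delta1_comprehension
    (P := fun x => ∃ b c, SolvesBelow Φ (x + 1) (InCode b c) ∧ InCode b c x)
    (Q := fun x => ∃ b c, SolvesBelow Φ (x + 1) (InCode b c) ∧ ¬InCode b c x)
    (.ex (.ex (.delta0 (.and (.solvesBelow delta0_Φ (.add (.var 2) (.const 1)) (.var 1) (.var 0))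
      (.inCode (.var 1) (.var 0) (.var 2))))))
    (.ex (.ex (.delta0 (.and (.solvesBelow delta0_Φ (.add (.var 2) (.const 1)) (.var 1) (.var 0))
      (.not (.inCode (.var 1) (.var 0) (.var 2))))))) fun x => by
      constructor
      · rintro ⟨b, c, h, hx⟩ ⟨b', c', h', hx'⟩
        exact hx' ((h.inCode_unique local_Φ h' x (lt_add_one x)).1 hx)
      · intro hx
        obtain ⟨b, c, h⟩ := solution (x + 1)
        exact ⟨b, c, h, by_contra fun hbc => hx ⟨b, c, h, hbc⟩⟩
  have mem_G_iff {n b c : M.Num} (h : SolvesBelow Φ n (InCode b c)) :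
      ∀ x < n, InCode b c x ↔ x ∈ G := by
    intro x hx
    have hx1 : SolvesBelow Φ (x + 1) (InCode b c) := fun y hy =>
      h y (hy.trans_le (Order.add_one_le_of_lt hx))
    refine ⟨fun hbc => (hG x).2 ⟨b, c, hx1, hbc⟩, fun hxG => ?_⟩
    obtain ⟨b', c', h', hbc'⟩ := (hG x).1 hxG
    exact (h'.inCode_unique local_Φ hx1 x (lt_add_one x)).1 hbc'
  refine ⟨G, fun x => ?_⟩
  obtain ⟨b, c, h⟩ := solution (x + 1)
  exact h.congr local_Φ (mem_G_iff h) x (lt_add_one x)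

/-! ### Collection -/

theorem delta0_collection {R : M.Num → M.Num → Prop}
    (hR : IsDelta0 fun x : Fin 2 → M.Num => R (x 0) (x 1)) {n : M.Num}
    (h : ∀ i < n, ∃ l, R i l) : ∃ b, ∀ i < n, ∃ l < b, R i l := by
  suffices bounded : ∀ k, ∃ b, ∀ i < k, i < n → ∃ l < b, R i l from
    (bounded n).imp fun b hb i hi => hb i hi hi
  refine IsRCA.sigma1_induction (P := fun k => ∃ b, ∀ i < k, i < n → ∃ l < b, R i l)
    (.ex (.delta0 (.allLT (.var 1) (.imp (.lt (.var 0) (.const n)) (.exLT (.var 1)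
      (hR.comp (σ := ![fun x => x 1, fun x => x 0])
        (Fin.cases (.var 1) (Fin.cases (.var 0) fun i => i.elim0))))))))
    ⟨0, fun i hi => absurd hi not_lt_zero⟩ ?_
  rintro k ⟨b, hb⟩
  by_cases hk : k < n
  · obtain ⟨l, hl⟩ := h k hk
    refine ⟨max b (l + 1), fun i hi hin => ?_⟩
    obtain rfl | hi := (Order.lt_add_one_iff.1 hi).eq_or_lt
    · exact ⟨l, lt_max_of_lt_right (lt_add_one l), hl⟩
    · obtain ⟨m, hm, hR⟩ := hb i hi hin
      exact ⟨m, lt_max_of_lt_left hm, hR⟩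
  · refine ⟨b, fun i hi hin => hb i (lt_of_le_of_ne (Order.lt_add_one_iff.1 hi) ?_) hin⟩
    rintro rfl
    exact hk hin

end Model

/-! ### Merging of colours -/

section Merging

variable {α κ : Type*}

/-- The numbers `i` and `j` merge at `l`: they lie below `l` and have the same colour with `l`. -/
def MergeAt [LT α] (col : α → α → κ) (i j l : α) : Prop := i < l ∧ j < l ∧ col i l = col j l

/-- A colouring is coherent if two numbers that merge once stay merged. Additivity is used only
through this property. -/
def Coherent [LT α] (col : α → α → κ) : Prop :=
  ∀ ⦃i j l m⦄, MergeAt col i j l → l < m → col i m = col j m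

variable {col : α → α → κ} {i j l m : α}

theorem MergeAt.mono [PartialOrder α] (hcol : Coherent col) (h : MergeAt col i j l) (hlm : l ≤ m) :
    MergeAt col i j m := by
  obtain rfl | hlm := hlm.eq_or_lt
  · exact h
  · exact ⟨h.1.trans hlm, h.2.1.trans hlm, hcol h hlm⟩

theorem coherent_of_additive [LT α] [Mul κ]
    (hcol : ∀ ⦃i j k⦄, i < j → j < k → col i j * col j k = col i k) : Coherent col :=
  fun i j l m h hlm => by rw [← hcol h.1 hlm, ← hcol h.2.1 hlm, h.2.2]

theorem exists_limit_colour [Preorder α] [IsDirectedOrder α] [Nonempty α] [NoMaxOrder α]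
    [Finite κ] (hcol : Coherent col) :
    ∃ (cls : α → κ) (r : α), (∀ i j, (∃ l, MergeAt col i j l) ↔ cls i = cls j) ∧
      ∀ n, ∃ i > n, r < i ∧ col r i = cls r ∧ cls i = cls r := by
  set U : Ultrafilter α := .of atTop
  have eventually_of_atTop {p : α → Prop} (hp : ∀ᶠ x in atTop, p x) : ∀ᶠ x in U, p x :=
    hp.filter_mono (Ultrafilter.of_le atTop)
  choose cls col_eq using fun i =>
    (U.eventually_exists_iff (P := fun a l => col i l = a)).1 (.of_forall fun l => ⟨col i l, rfl⟩)
  obtain ⟨a, cls_eq⟩ :=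
    (U.eventually_exists_iff (P := fun a i => cls i = a)).1 (.of_forall fun i => ⟨cls i, rfl⟩)
  obtain ⟨r, hr⟩ := cls_eq.exists
  refine ⟨cls, r, fun i j => ⟨fun ⟨l, hl⟩ => ?_, fun hij => ?_⟩, fun n => ?_⟩
  · obtain ⟨m, hi, hj, hlm⟩ :=
      ((col_eq i).and ((col_eq j).and (eventually_of_atTop (eventually_gt_atTop l)))).exists
    rw [← hi, ← hj, hcol hl hlm]
  · obtain ⟨l, hi, hj, hil, hjl⟩ :=
      ((col_eq i).and ((col_eq j).and ((eventually_of_atTop (eventually_gt_atTop i)).and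
        (eventually_of_atTop (eventually_gt_atTop j))))).exists
    exact ⟨l, hil, hjl, hi.trans (hij.trans hj.symm)⟩
  · obtain ⟨i, hri, hi, hni, hri'⟩ :=
      ((col_eq r).and (cls_eq.and ((eventually_of_atTop (eventually_gt_atTop n)).and
        (eventually_of_atTop (eventually_gt_atTop r))))).exists
    exact ⟨i, hni, hri', hri, hi.trans hr.symm⟩

end Merging

namespace Model

section Cliques

variable {κ : Type*} {col : M.Num → M.Num → κ}

/-- A colouring of the pairs `i < j` by a finite set of colours is `Δ⁰₀` if each of its colour
classes is; its values at other arguments are irrelevant. -/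
def IsDelta0Colouring (col : M.Num → M.Num → κ) : Prop :=
  ∀ a, IsDelta0 fun x : Fin 2 → M.Num => x 0 < x 1 ∧ col (x 0) (x 1) = a

theorem IsDelta0Colouring.colour_eq (hcol : IsDelta0Colouring col) (a : κ) {n : ℕ}
    {f g : (Fin n → M.Num) → M.Num} (hf : IsTermFun f) (hg : IsTermFun g) :
    IsDelta0 fun x => f x < g x ∧ col (f x) (g x) = a :=
  (hcol a).comp (σ := ![f, g]) (Fin.cases hf (Fin.cases hg fun i => i.elim0))

theorem IsDelta0Colouring.mergeAt [Finite κ] (hcol : IsDelta0Colouring col) {n : ℕ}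
    {f g h : (Fin n → M.Num) → M.Num} (hf : IsTermFun f) (hg : IsTermFun g) (hh : IsTermFun h) :
    IsDelta0 fun x => MergeAt col (f x) (g x) (h x) :=
  (IsDelta0.exists_finite fun a => (hcol.colour_eq a hf hh).and (hcol.colour_eq a hg hh)).congr
    fun _ => ⟨fun ⟨hi, hj, hij⟩ => ⟨_, ⟨hi, hij⟩, hj, rfl⟩,
      fun ⟨_, ⟨hi, hia⟩, hj, hja⟩ => ⟨hi, hj, hia.trans hja.symm⟩⟩

variable [M.IsRCA]

theorem exists_greedy_clique (delta0_col : IsDelta0Colouring col) (A : M.Sets) (a : κ) :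
    ∃ I : M.Sets, ∀ x, x ∈ I ↔ x ∈ A ∧ ∀ y < x, y ∈ I → y < x ∧ col y x = a :=
  exists_set_of_recursion (Φ := fun x p => x ∈ A ∧ ∀ y < x, p y → y < x ∧ col y x = a)
    (fun _ _ _ hpq => and_congr_right fun _ => forall₂_congr fun y hy => imp_congr_left (hpq y hy))
    (.and (.mem (.var 0) A) (.allLT (.var 0) (.imp (.inCode (.var 2) (.var 3) (.var 0))
      (delta0_col.colour_eq a (.var 0) (.var 1)))))

variable [Finite κ]

theorem exists_set_of_mergingClass (delta0_col : IsDelta0Colouring col) {ι : Type*} [Finite ι]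
    {cls : M.Num → ι} (merge_iff : ∀ i j, (∃ l, MergeAt col i j l) ↔ cls i = cls j) (r : M.Num) :
    ∃ A : M.Sets, ∀ i, i ∈ A ↔ cls r = cls i := by
  have : Nonempty ι := ⟨cls r⟩
  let rep : ι → M.Num := Function.invFun cls
  have cls_rep (i : M.Num) : cls (rep (cls i)) = cls i := Function.invFun_eq ⟨i, rfl⟩
  obtain ⟨A, hA⟩ := IsRCA.delta1_comprehension (P := fun i => ∃ l, MergeAt col r i l)
    (Q := fun i => ∃ l, ∃ c, cls (rep c) ≠ cls r ∧ MergeAt col (rep c) i l)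
    (.ex (.delta0 (delta0_col.mergeAt (.const r) (.var 1) (.var 0))))
    (.ex (.delta0 (.exists_finite fun c => .and (.const _)
      (delta0_col.mergeAt (.const (rep c)) (.var 1) (.var 0))))) fun i => by
      rw [merge_iff]
      constructor
      · rintro hi ⟨l, c, hc, hl⟩
        exact hc (((merge_iff _ _).1 ⟨l, hl⟩).trans hi.symm)
      · intro h
        obtain ⟨l, hl⟩ := (merge_iff _ i).2 (cls_rep i)
        exact by_contra fun hi => h ⟨l, cls i, fun hc => hi (hc.symm.trans (cls_rep i)), hl⟩
  exact ⟨A, fun i => (hA i).trans (merge_iff r i)⟩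

theorem exists_unbounded_set_merging (delta0_col : IsDelta0Colouring col)
    (coherent : Coherent col) :
    ∃ (r : M.Num) (a : κ) (A : M.Sets), (∀ n, ∃ i > n, i ∈ A) ∧
      ∀ i ∈ A, col r i = a ∧ ∃ l, MergeAt col r i l := by
  obtain ⟨cls, r, merge_iff, unbounded⟩ := exists_limit_colour coherent
  obtain ⟨A, hA⟩ := exists_set_of_mergingClass delta0_col merge_iff r
  obtain ⟨B, hB⟩ := delta0_comprehension
    (P := fun i => i ∈ A ∧ r < i ∧ col r i = cls r)
    (.and (.mem (.var 0) A) (delta0_col.colour_eq _ (.const r) (.var 0)))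
  refine ⟨r, cls r, B, fun n => ?_, fun i hi => ?_⟩
  · obtain ⟨i, hni, hri, hcol, hcls⟩ := unbounded n
    exact ⟨i, hni, (hB i).2 ⟨(hA i).2 hcls.symm, hri, hcol⟩⟩
  · obtain ⟨hiA, -, hcol⟩ := (hB i).1 hi
    exact ⟨hcol, (merge_iff r i).2 ((hA i).1 hiA)⟩

theorem exists_common_merge (delta0_col : IsDelta0Colouring col) (coherent : Coherent col)
    {r : M.Num} {A : M.Sets} (hA : ∀ i ∈ A, ∃ l, MergeAt col r i l) (n : M.Num) :
    ∃ l, ∀ i ∈ A, i < n → MergeAt col r i l := by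
  obtain ⟨b, hb⟩ := delta0_collection (R := fun i l => i ∈ A → MergeAt col r i l) (n := n)
    (.imp (.mem (.var 0) A) (delta0_col.mergeAt (.const r) (.var 0) (.var 1)))
    fun i _ => by
      by_cases hi : i ∈ A
      · exact (hA i hi).imp fun l hl _ => hl
      · exact ⟨0, fun h => absurd h hi⟩
  refine ⟨b, fun i hiA hi => ?_⟩
  obtain ⟨l, hlb, hl⟩ := hb i hi
  exact (hl hiA).mono coherent hlb.le

theorem exists_unbounded_clique (delta0_col : IsDelta0Colouring col) (coherent : Coherent col) :
    ∃ (a : κ) (I : M.Sets), (∀ n, ∃ i > n, i ∈ I) ∧ ∀ i ∈ I, ∀ j ∈ I, i < j → col i j = a := by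
  obtain ⟨r, a, A, unbounded, hA⟩ := exists_unbounded_set_merging delta0_col coherent
  obtain ⟨I, mem_I⟩ := exists_greedy_clique delta0_col A a
  refine ⟨a, I, fun n => ?_, fun i hi j hj hij => (((mem_I j).1 hj).2 i hij hi).2⟩
  by_contra! hn
  obtain ⟨l, hl⟩ := exists_common_merge delta0_col coherent (fun i hi => (hA i hi).2) (n + 1)
  obtain ⟨x, hx, hxA⟩ := unbounded (max n l)
  obtain ⟨hnx, hlx⟩ := max_lt_iff.1 hx
  refine hn x hnx ((mem_I x).2 ⟨hxA, fun y hyx hy => ⟨hyx, ?_⟩⟩)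
  have hyn : y < n + 1 := Order.lt_add_one_iff.2 (not_lt.1 fun hny => hn y hny hy)
  have merge : MergeAt col r y x := (hl y ((mem_I y).1 hy).1 hyn).mono coherent hlx.le
  exact merge.2.2.symm.trans (hA x hxA).1

end Cliques

/-! ### The sentence in a structure -/

/-- The pairing of the coded pairs of numbers, `⟨a, b⟩ = (a + b)² + a`. -/
def pair (a b : M.Num) : M.Num := (a + b) * (a + b) + a

theorem eval_pair {n : ℕ} (x : Fin n → M.Num) (t₁ t₂ : Term n) :
    (Term.pair t₁ t₂).eval M x = pair (t₁.eval M x) (t₂.eval M x) :=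
  rfl

theorem IsTermFun.pair {n : ℕ} {f g : (Fin n → M.Num) → M.Num} (hf : IsTermFun f)
    (hg : IsTermFun g) : IsTermFun fun x => pair (f x) (g x) :=
  .add (.mul (.add hf hg) (.add hf hg)) hf

variable [M.IsRCA] {S : Type w} {s k : ℕ} {e : S ≃ Fin s} {X : Fin k → M.Sets} {C : Fin k}
  {col : M.Num → M.Num → S}

/-- The set `A` represents the colouring `col` of the pairs `i < j`, a colour `a` being coded by its
number `e a`. -/
def Represents (e : S ≃ Fin s) (A : M.Sets) (col : M.Num → M.Num → S) : Prop :=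
  ∀ ⦃i j⦄, i < j → ∀ a, pair (pair i j) (e a : ℕ) ∈ A ↔ col i j = a

theorem Represents.isDelta0Colouring {A : M.Sets} (h : Represents e A col) :
    IsDelta0Colouring col := fun a =>
  (IsDelta0.and (.lt (.var 0) (.var 1))
    (.mem (.pair (.pair (.var 0) (.var 1)) (.const (e a : ℕ))) A)).congr fun _ =>
      and_congr_right fun hij => (h hij a).symm

theorem exists_represents (e : S ≃ Fin s) {x : Fin 0 → M.Num}
    (h : (Formula.isColouring s C).Holds M X x) : ∃ col, Represents e (X C) col := by
  have exists_colour (i j : M.Num) (hij : i < j) :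
      ∃ a, ∀ b, pair (pair i j) (e b : ℕ) ∈ X C ↔ a = b := by
    have exists_unique_code := h.2 i j
    simp only [Formula.holds_imp, Formula.Holds, eval_numeral, Formula.colourEq, eval_pair]
      at exists_unique_code
    obtain ⟨c, ⟨hc, hmem⟩, unique⟩ := exists_unique_code hij
    obtain ⟨p, rfl⟩ := exists_natCast_eq_of_lt hc
    refine ⟨e.symm p, fun b => ⟨fun hb => e.symm_apply_eq.2 (Fin.ext ?_), ?_⟩⟩
    · exact (Nat.cast_injective (unique (e b : ℕ) ⟨Nat.cast_lt (α := M.Num).2 (e b).2, hb⟩)).symm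
    · rintro rfl
      rw [e.apply_symm_apply]
      exact hmem
  have : Nonempty S := ⟨(exists_colour 0 1 zero_lt_one).choose⟩
  choose! col hcol using exists_colour
  exact ⟨col, hcol⟩

theorem holds_mulTable [Mul S] (e : S ≃ Fin s) {n : ℕ} (x : Fin n → M.Num) (t₁ t₂ t₃ : Term n) :
    (Formula.mulTable e t₁ t₂ t₃).Holds M X x ↔
      ∃ a b, t₁.eval M x = (e a : ℕ) ∧ t₂.eval M x = (e b : ℕ) ∧
        t₃.eval M x = (e (a * b) : ℕ) := by
  simp only [Formula.mulTable, Formula.holds_disj, List.mem_map, List.mem_product,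
    List.mem_finRange, and_self, true_and, Prod.exists, exists_exists_exists_and_eq,
    Formula.Holds, eval_numeral, and_assoc, e.symm.exists_congr_left, e.symm_symm,
    e.symm_apply_apply]

theorem Represents.mul_eq [Mul S] (hcol : Represents e (X C) col) {x : Fin 0 → M.Num}
    (h : (Formula.isAdditive e C).Holds M X x) ⦃i j l : M.Num⦄ (hij : i < j) (hjl : j < l) :
    col i j * col j l = col i l := by
  have table := h i j l (e (col i j) : ℕ) (e (col j l) : ℕ) (e (col i l) : ℕ)
  rw [Formula.holds_imp, holds_mulTable] at table
  obtain ⟨a, b, ha, hb, hab⟩ := table ⟨⟨hij, hjl⟩,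
    ⟨(hcol hij _).2 rfl, (hcol hjl _).2 rfl⟩, (hcol (hij.trans hjl) _).2 rfl⟩
  have code_injective {c d : S} (hcd : ((e c : ℕ) : M.Num) = (e d : ℕ)) : c = d :=
    e.injective (Fin.ext (Nat.cast_injective hcd))
  rw [code_injective ha, code_injective hb, code_injective hab]

theorem Represents.holds_isClique (hcol : Represents e (X C) col) {I : Fin k} {a : S} {n : ℕ}
    {x : Fin n → M.Num} {t : Term n} (ht : t.eval M x = (e a : ℕ))
    (clique : ∀ i ∈ X I, ∀ j ∈ X I, i < j → col i j = a) :
    (Formula.isClique C I t).Holds M X x := by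
  intro i j
  simp only [Formula.holds_imp, Formula.colourEq, Formula.Holds, eval_pair, Term.eval_lift]
  rintro ⟨⟨hi, hj⟩, hij⟩
  exact ht ▸ (hcol hij a).2 (clique i hi j hj hij)

end Model

end SOArith

theorem mainTheorem11_general {S : Type w} [Mul S] {s : ℕ} (e : S ≃ Fin s) :
    SOArith.Proves.{u, v} SOArith.RCA₀ (SOArith.Formula.additiveRamsey e) := by
  intro M hM C
  have : M.IsRCA := SOArith.Model.isRCA_of_satisfies hM
  have : Finite S := .of_equiv _ e.symm
  simp only [SOArith.Formula.holds_imp, SOArith.Formula.holds_exLT, SOArith.Model.eval_numeral]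
  rintro ⟨isColouring, isAdditive⟩
  obtain ⟨col, hcol⟩ := SOArith.Model.exists_represents e isColouring
  obtain ⟨a, I, unbounded, clique⟩ := SOArith.Model.exists_unbounded_clique
    hcol.isDelta0Colouring (SOArith.coherent_of_additive (hcol.mul_eq isAdditive))
  exact ⟨(e a : ℕ), Nat.cast_lt (α := M.Num).2 (e a).2, I, unbounded,
    SOArith.Model.Represents.holds_isClique
      (X := Fin.cons I (Fin.cons C Fin.elim0)) (C := 1) hcol rfl clique⟩

theorem mainTheorem11 {S : Type w} [Semigroup S] [Finite S] (e : S ≃ Fin (Nat.card S)) :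
    SOArith.Proves.{u, v} SOArith.RCA₀ (SOArith.Formula.additiveRamsey e) :=
  mainTheorem11_general e
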